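/- Let $K$ be a field, $n\ge 3$, let $X=(x_{ij})$ and $Y=(y_{ij})$ be $n\times n$ matrices of indeterminates over $K$, and let $R=K[x_{ij},y_{ij} : 1\le i,j\le n]$ with its standard grading. Let $J\subset R$ be the (homogeneous) ideal generated by the anti-diagonal entries $c_{i,\,n+1-i}$ $(1\le i\le n)$ of the commutator matrix $C=XY-YX=(c_{ij})$. Then the $2n^2-n$ elements $$x_{ij}\ (2\le i\le n,\ 1\le j\le n),\qquad y_{ij}\ (1\le i\le n,\ 2\le j\le n),\qquad x_{1j}-y_{n-j+1,1}\ (1\le j\le n)$$ form, in any order, a homogeneous system of parameters and a regular sequence on $R/J$. (A homogeneous system of parameters of $R/J$ is a sequence of $\dim R/J$ homogeneous elements of positive degree such that the quotient of $R/J$ by the ideal they generate has Krull dimension $0$.) Moreover, if $L\subset R$ is the ideal generated by these elements, then there is an isomorphism of $K$-algebras from $R/L$ to the polynomial ring $K[x_{11},\dots,x_{1n}]$ that sends the class of $x_{1j}$ to $x_{1j}$ for every $j$ and maps the image of $J$ in $R/L$ onto the ideal $(x_{11}^2,\dots,x_{1n}^2)$. -/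

import Mathlib

noncomputable section

namespace CommutatorMatrix

open MvPolynomial

section Graded

variable {K A : Type*} [Field K] [CommRing A] [Algebra K A]

/-- The degree `d` part of `A / I`, the image of the degree `d` part of `A`. -/
def quotientGrading (𝒜 : ℕ → Submodule K A) (I : Ideal A) (d : ℕ) : Submodule K (A ⧸ I) :=
  (𝒜 d).map (Ideal.Quotient.mkₐ K I).toLinearMap

theorem quotientGrading_gradedMonoid (𝒜 : ℕ → Submodule K A) [SetLike.GradedMonoid 𝒜]
    (I : Ideal A) : SetLike.GradedMonoid (quotientGrading 𝒜 I) where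
  one_mem := ⟨1, SetLike.GradedOne.one_mem, map_one (Ideal.Quotient.mkₐ K I)⟩
  mul_mem := by
    rintro i j _ _ ⟨a, ha, rfl⟩ ⟨b, hb, rfl⟩
    exact ⟨a * b, SetLike.GradedMul.mul_mem ha hb, map_mul (Ideal.Quotient.mkₐ K I) a b⟩

/-- The decomposition of `a : A` into homogeneous components, reduced modulo `I`. -/
def quotientDecompose (𝒜 : ℕ → Submodule K A) [GradedAlgebra 𝒜] (I : Ideal A) :
    A →ₗ[K] DirectSum ℕ fun d => quotientGrading 𝒜 I d :=
  (DirectSum.lmap fun d => (Ideal.Quotient.mkₐ K I).toLinearMap.submoduleMap (𝒜 d)) ∘ₗ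
    (DirectSum.decomposeLinearEquiv 𝒜).toLinearMap

theorem quotientDecompose_apply (𝒜 : ℕ → Submodule K A) [GradedAlgebra 𝒜] (I : Ideal A)
    (a : A) (d : ℕ) : ((quotientDecompose 𝒜 I a d : quotientGrading 𝒜 I d) : A ⧸ I) =
      Ideal.Quotient.mk I (DirectSum.decompose 𝒜 a d : A) := by
  rfl

theorem quotientDecompose_eq_zero (𝒜 : ℕ → Submodule K A) [GradedAlgebra 𝒜] {I : Ideal A}
    (hI : I.IsHomogeneous 𝒜) (a : A) (ha : a ∈ I) : quotientDecompose 𝒜 I a = 0 := by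
  refine DFinsupp.ext fun d => Subtype.ext ?_
  rw [quotientDecompose_apply]
  exact Ideal.Quotient.eq_zero_iff_mem.2 (hI d ha)

theorem quotientDecompose_of_mem (𝒜 : ℕ → Submodule K A) [GradedAlgebra 𝒜] (I : Ideal A)
    {a : A} {d : ℕ} (ha : a ∈ 𝒜 d) : quotientDecompose 𝒜 I a =
      DirectSum.of (fun d => quotientGrading 𝒜 I d) d
        ⟨Ideal.Quotient.mk I a, Submodule.mem_map_of_mem ha⟩ := by
  refine DFinsupp.ext fun e => Subtype.ext ?_
  rw [quotientDecompose_apply, DirectSum.decompose_of_mem 𝒜 ha]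
  by_cases h : d = e
  · subst h
    rw [DirectSum.of_eq_same, DirectSum.of_eq_same]
  · rw [DirectSum.of_eq_of_ne _ _ _ (Ne.symm h), DirectSum.of_eq_of_ne _ _ _ (Ne.symm h)]
    exact map_zero _

theorem quotientDecompose_surjective (𝒜 : ℕ → Submodule K A) [GradedAlgebra 𝒜] (I : Ideal A) :
    Function.Surjective (quotientDecompose 𝒜 I) := by
  intro z
  induction z using DirectSum.induction_on with
  | zero => exact ⟨0, map_zero _⟩
  | of d x =>
    obtain ⟨_, a, ha, rfl⟩ := x
    exact ⟨a, quotientDecompose_of_mem 𝒜 I ha⟩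
  | add x y hx hy =>
    obtain ⟨a, rfl⟩ := hx
    obtain ⟨b, rfl⟩ := hy
    exact ⟨a + b, map_add _ _ _⟩

theorem coe_quotientDecompose (𝒜 : ℕ → Submodule K A) [GradedAlgebra 𝒜] (I : Ideal A) (a : A) :
    DirectSum.coeAddMonoidHom (quotientGrading 𝒜 I) (quotientDecompose 𝒜 I a) =
      Ideal.Quotient.mk I a := by
  refine DirectSum.Decomposition.inductionOn 𝒜 (by simp) (fun {d} x => ?_)
    (fun x y hx hy => by rw [map_add, map_add, hx, hy, map_add]) a
  rw [quotientDecompose_of_mem 𝒜 I x.2]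
  exact DirectSum.coeAddMonoidHom_of _ _ _

/-- The quotient of a graded algebra by a homogeneous ideal is graded. -/
@[reducible] def quotientGradedAlgebra (𝒜 : ℕ → Submodule K A) [GradedAlgebra 𝒜] {I : Ideal A}
    (hI : I.IsHomogeneous 𝒜) : GradedAlgebra (quotientGrading 𝒜 I) where
  toGradedMonoid := quotientGrading_gradedMonoid 𝒜 I
  decompose' x := quotientDecompose 𝒜 I x.out
  left_inv x := (coe_quotientDecompose 𝒜 I _).trans (Ideal.Quotient.mk_out x)
  right_inv z := by
    obtain ⟨a, rfl⟩ := quotientDecompose_surjective 𝒜 I z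
    rw [coe_quotientDecompose]
    refine sub_eq_zero.1 ((map_sub (quotientDecompose 𝒜 I) _ _).symm.trans ?_)
    exact quotientDecompose_eq_zero 𝒜 hI _
      (Ideal.Quotient.eq.1 (Ideal.Quotient.mk_out (Ideal.Quotient.mk I a)))

/-- A homogeneous system of parameters of an `ℕ`-graded `K`-algebra `A`: homogeneous elements of
positive degree, as many as the Krull dimension of `A`, modulo which `A` has Krull dimension
zero. -/
structure IsHomogeneousSystemOfParameters (𝒜 : ℕ → Submodule K A) [GradedAlgebra 𝒜]
    (fs : List A) : Prop where
  homogeneous : ∀ f ∈ fs, ∃ d, 0 < d ∧ f ∈ 𝒜 d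
  length_eq : ringKrullDim A = fs.length
  dim_quotient : ringKrullDim (A ⧸ Ideal.ofList fs) = 0

end Graded

variable (K : Type*) [Field K] (n : ℕ)

/-- The polynomial ring `K[X, Y]` in the entries of two `n × n` matrices; the variables
`Sum.inl (i, j)` and `Sum.inr (i, j)` are `x_{ij}` and `y_{ij}`, with indices from `0`. -/
abbrev PolyRing : Type _ := MvPolynomial ((Fin n × Fin n) ⊕ (Fin n × Fin n)) K

/-- The generic matrix `(x_{ij})`. -/
def matX : Matrix (Fin n) (Fin n) (PolyRing K n) := Matrix.of fun i j => X (Sum.inl (i, j))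

/-- The generic matrix `(y_{ij})`. -/
def matY : Matrix (Fin n) (Fin n) (PolyRing K n) := Matrix.of fun i j => X (Sum.inr (i, j))

/-- The commutator matrix `XY - YX`. -/
def commMatrix : Matrix (Fin n) (Fin n) (PolyRing K n) :=
  matX K n * matY K n - matY K n * matX K n

/-- The ideal `J` generated by the anti-diagonal entries of the commutator matrix. -/
def antiDiagIdeal : Ideal (PolyRing K n) :=
  Ideal.span (Set.range fun i : Fin n => commMatrix K n i i.rev)

theorem isHomogeneous_commMatrix (i j : Fin n) : (commMatrix K n i j).IsHomogeneous 2 := by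
  simp only [commMatrix, matX, matY, Matrix.sub_apply, Matrix.mul_apply, Matrix.of_apply]
  exact (IsHomogeneous.sum _ _ _ fun k _ => (isHomogeneous_X K _).mul (isHomogeneous_X K _)).sub
    (IsHomogeneous.sum _ _ _ fun k _ => (isHomogeneous_X K _).mul (isHomogeneous_X K _))

/-- The grading of `R / J` induced by the standard grading of the polynomial ring `R`. -/
abbrev antiDiagGrading : ℕ → Submodule K (PolyRing K n ⧸ antiDiagIdeal K n) :=
  quotientGrading (homogeneousSubmodule ((Fin n × Fin n) ⊕ (Fin n × Fin n)) K)
    (antiDiagIdeal K n)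

instance antiDiagGradedAlgebra : GradedAlgebra (antiDiagGrading K n) :=
  letI := MvPolynomial.gradedAlgebra (σ := (Fin n × Fin n) ⊕ (Fin n × Fin n)) (R := K)
  quotientGradedAlgebra _ (I := antiDiagIdeal K n) (by
    refine Ideal.homogeneous_span _ _ ?_
    rintro _ ⟨i, rfl⟩
    exact ⟨2, isHomogeneous_commMatrix K n i i.rev⟩)

/-- The elements `x_{ij}` outside the first row of `X`, `y_{ij}` outside the first column of `Y`,
and `x_{1j} - y_{n-j+1,1}`, written with indices from `0`. -/
def parameterList [NeZero n] : List (PolyRing K n) :=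
  ((List.finRange n ×ˢ List.finRange n).filter fun p => p.1 ≠ 0).map
      (fun p => matX K n p.1 p.2) ++
    ((List.finRange n ×ˢ List.finRange n).filter fun p => p.2 ≠ 0).map
      (fun p => matY K n p.1 p.2) ++
    (List.finRange n).map fun j => matX K n 0 j - matY K n j.rev 0

end CommutatorMatrix

end

/-! Modulo the parameters only the first row of `X` and first column of `Y` survive, identified with
each other in reverse order, and the anti-diagonal entries of `C` become the negatives of the
squares of the `n` surviving variables (`restrict_commMatrix_rev`). A linear automorphism carries
variables to the parameters and fixes the first row of `X`, so the parameters followed by these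
squares are regular in `R`. Replacing the squares by the congruent elements `-c_{i,n+1-i}` keeps
regularity. All these elements are homogeneous of positive degree, so the generators of `J` may be
moved to the front (`perm_of_homogeneous`); hence the parameters are regular on `R/J`. Counting
dimensions along the whole sequence then forces `dim R/J = 2n² - n` and a zero-dimensional quotient.
-/

namespace RingTheory.Sequence

/-! ### Permutation, congruence and dimension for regular sequences -/

/-- A weakly regular sequence of homogeneous elements of positive degree in an `ℕ`-graded ring
stays weakly regular under permutation. -/
theorem IsWeaklyRegular.perm_of_homogeneous {A σ : Type*} [CommRing A] [SetLike σ A]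
    [AddSubgroupClass σ A] (𝒜 : ℕ → σ) [GradedRing 𝒜] {rs rs' : List A}
    (h : IsWeaklyRegular A rs) (hp : rs.Perm rs') (hh : ∀ r ∈ rs, ∃ d, 0 < d ∧ r ∈ 𝒜 d) :
    IsWeaklyRegular A rs' := by
  refine h.prototype_perm hp fun a b t hsub => ?_
  intro N hN
  obtain ⟨d, hd, had⟩ := hh a (hsub.subset (by simp))
  have hI : (Ideal.ofList t).IsHomogeneous 𝒜 := by
    refine Ideal.homogeneous_span _ _ fun r hr => ?_
    obtain ⟨e, -, he⟩ := hh r (hsub.subset (by simp [show r ∈ t from hr]))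
    exact ⟨e, he⟩
  -- Graded Nakayama: `N`, the `b`-torsion modulo `t`, satisfies `N = aN`, so its elements are
  -- divisible by every power of `a`.
  have key : ∀ k : ℕ, ∀ x ∈ N, ∃ g : A, x = Submodule.Quotient.mk (a ^ k * g) := by
    intro k
    induction k with
    | zero =>
      intro x _
      obtain ⟨g, rfl⟩ := Submodule.Quotient.mk_surjective _ x
      exact ⟨g, by simp⟩
    | succ k ih =>
      intro x hx
      rw [hN] at hx
      obtain ⟨y, hy, rfl⟩ := Submodule.mem_smul_pointwise_iff_exists _ _ _ |>.1 hx
      obtain ⟨g, rfl⟩ := ih y hy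
      exact ⟨g, by rw [← Submodule.Quotient.mk_smul, pow_succ', mul_assoc]; rfl⟩
  rw [eq_bot_iff]
  intro x hx
  obtain ⟨f, rfl⟩ := Submodule.Quotient.mk_surjective _ x
  rw [Submodule.mem_bot, Submodule.Quotient.mk_eq_zero, smul_eq_mul, Ideal.mul_top]
  rw [hI.mem_iff]
  intro e
  -- Since `a` has degree at least 1, a multiple of `a ^ (e + 1)` has no component in degree `e`.
  obtain ⟨g, hg⟩ := key (e + 1) _ hx
  rw [Submodule.Quotient.eq, smul_eq_mul, Ideal.mul_top] at hg
  have h1 := hI e hg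
  have h2 : (DirectSum.decompose 𝒜 (a ^ (e + 1) * g) e : A) = 0 :=
    DirectSum.coe_decompose_mul_of_left_mem_of_not_le 𝒜
      (SetLike.pow_mem_graded (e + 1) had) (by rw [smul_eq_mul]; nlinarith)
  rw [DirectSum.decompose_sub, DirectSum.sub_apply, AddSubgroupClass.coe_sub, h2, sub_zero] at h1
  exact h1

/-- Multiplication on `A/(rs)` depends only on classes modulo `rs`. -/
theorem isWeaklyRegular_append_congr {A : Type*} [CommRing A] {rs as bs : List A}
    (h : List.Forall₂ (fun a b => a - b ∈ Ideal.ofList rs) as bs)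
    (has : IsWeaklyRegular A (rs ++ as)) : IsWeaklyRegular A (rs ++ bs) := by
  rw [isWeaklyRegular_append_iff] at has ⊢
  refine ⟨has.1, ((AddEquiv.refl _).isWeaklyRegular_congr (h.imp fun a b hab x => ?_)).1 has.2⟩
  obtain ⟨g, rfl⟩ := Submodule.Quotient.mk_surjective _ x
  simp only [AddEquiv.refl_apply]
  rw [← Submodule.Quotient.mk_smul, ← Submodule.Quotient.mk_smul, Submodule.Quotient.eq,
    smul_eq_mul, smul_eq_mul, smul_eq_mul, ← sub_mul, Ideal.mul_top]
  exact Ideal.mul_mem_right _ _ hab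

theorem IsWeaklyRegular.map_quotient_of_append {A : Type*} [CommRing A] {rs ss : List A}
    (h : IsWeaklyRegular A (rs ++ ss)) {I : Ideal A} (hI : Ideal.ofList rs = I) :
    IsWeaklyRegular (A ⧸ I) (ss.map (Ideal.Quotient.mk I)) := by
  have h2 := ((isWeaklyRegular_append_iff _ _ _).1 h).2
  rw [(Submodule.quotEquivOfEq _ I (by rw [smul_eq_mul, Ideal.mul_top, hI])).isWeaklyRegular_congr]
    at h2
  exact (isWeaklyRegular_map_algebraMap_iff (A ⧸ I) (A ⧸ I) ss).2 h2

-- A nonzerodivisor avoids the minimal primes of the support, so each term lowers the dimension by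
-- at least one.
open Module in
theorem IsWeaklyRegular.supportDim_add_length_le {A M : Type*} [CommRing A] [AddCommGroup M]
    [Module A M] [Module.Finite A M] {rs : List A} (h : IsWeaklyRegular M rs) :
    supportDim A (M ⧸ Ideal.ofList rs • (⊤ : Submodule A M)) + rs.length ≤ supportDim A M := by
  induction rs generalizing M with
  | nil =>
    rw [Ideal.ofList_nil, Submodule.bot_smul]
    simpa using (supportDim_eq_of_equiv (Submodule.quotEquivOfEqBot ⊥ rfl)).le
  | cons x rs ih =>
    rw [isWeaklyRegular_cons_iff] at h
    have h1 := supportDim_quotSMulTop_succ_le_of_notMem_minimalPrimes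
      (fun _ => h.1.notMem_of_mem_minimalPrimes (R := A) (M := M))
    rw [supportDim_eq_of_equiv (Submodule.quotOfListConsSMulTopEquivQuotSMulTopInner M x rs),
      List.length_cons, Nat.cast_add, Nat.cast_one, ← add_assoc]
    exact (add_le_add_left (ih h.2) 1).trans h1

theorem IsWeaklyRegular.ringKrullDim_add_length_le {A : Type*} [CommRing A] {rs : List A}
    (h : IsWeaklyRegular A rs) :
    ringKrullDim (A ⧸ Ideal.ofList rs) + rs.length ≤ ringKrullDim A := by
  have eq : Ideal.ofList rs = Ideal.ofList rs • (⊤ : Ideal A) := by simp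
  rw [ringKrullDim_eq_of_ringEquiv (Ideal.quotientEquivAlgOfEq A eq).toRingEquiv,
    ← Module.supportDim_quotient_eq_ringKrullDim, ← Module.supportDim_self_eq_ringKrullDim]
  exact h.supportDim_add_length_le

end RingTheory.Sequence

/-! ### Powers of variables -/

namespace MvPolynomial

open RingTheory.Sequence

/-- Powers of distinct variables form a weakly regular sequence in a polynomial ring. -/
theorem isWeaklyRegular_map_X_pow {σ R : Type*} [CommRing R] (l : List (σ × ℕ))
    (hl : (l.map Prod.fst).Nodup) :
    IsWeaklyRegular (MvPolynomial σ R) (l.map fun p => (X p.1 : MvPolynomial σ R) ^ p.2) := by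
  classical
  induction l using List.reverseRecOn with
  | nil => exact .nil _ _
  | append_singleton l p ih =>
    rw [List.map_append, List.map_singleton, List.nodup_append] at hl
    rw [List.map_append, List.map_singleton, isWeaklyRegular_append_iff,
      isWeaklyRegular_singleton_iff]
    refine ⟨ih hl.1, ?_⟩
    -- Membership in a monomial ideal can be tested on each monomial of the support.
    have hI : Ideal.ofList (l.map fun p => (X p.1 : MvPolynomial σ R) ^ p.2) =
        Ideal.span ((fun s => monomial s (1 : R)) ''
          {s | ∃ q ∈ l, Finsupp.single q.1 q.2 = s}) := by
      refine congrArg Ideal.span (Set.ext fun f => ?_)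
      simp [X_pow_eq_monomial]
    rw [isSMulRegular_iff_right_eq_zero_of_smul]
    intro x hx
    obtain ⟨f, rfl⟩ := Submodule.Quotient.mk_surjective _ x
    rw [← Submodule.Quotient.mk_smul] at hx
    rw [Submodule.Quotient.mk_eq_zero, smul_eq_mul, Ideal.mul_top, hI,
      mem_ideal_span_monomial_image] at hx ⊢
    intro m hm
    obtain ⟨_, ⟨q, hq, rfl⟩, hle⟩ := hx (m + Finsupp.single p.1 p.2) (by
      rw [mem_support_iff, smul_eq_mul, X_pow_eq_monomial, mul_comm, coeff_mul_monomial, mul_one]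
      exact mem_support_iff.1 hm)
    refine ⟨_, ⟨q, hq, rfl⟩, ?_⟩
    -- Multiplying by a power of another variable leaves the exponent of `q.1` unchanged.
    have hne : p.1 ≠ q.1 := fun e =>
      hl.2.2 q.1 (List.mem_map_of_mem hq) p.1 (by simp) e.symm
    rw [Finsupp.single_le_iff] at hle ⊢
    simpa [Finsupp.single_apply, hne] using hle

end MvPolynomial

noncomputable section

theorem Ideal.span_range_neg {ι A : Type*} [CommRing A] (f : ι → A) :
    Ideal.span (Set.range fun i => -f i) = Ideal.span (Set.range f) := by
  refine (congrArg Ideal.span (Set.ext fun a => ?_)).trans (Submodule.span_neg (Set.range f))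
  simp [eq_neg_iff_add_eq_zero, neg_eq_iff_add_eq_zero, add_comm]

/-! ### Linear change of variables -/

namespace CommutatorMatrix

open MvPolynomial RingTheory.Sequence

variable (K : Type*) [Field K] (n : ℕ)

/-- The negatives of the anti-diagonal entries of the commutator matrix. -/
def antiDiagList : List (PolyRing K n) := (List.finRange n).map fun i => -commMatrix K n i i.rev

theorem ofList_antiDiagList : Ideal.ofList (antiDiagList K n) = antiDiagIdeal K n := by
  refine (congrArg Ideal.span (Set.ext fun f => ?_)).trans (Ideal.span_range_neg _)
  simp [antiDiagList]

theorem isHomogeneous_of_mem_antiDiagList {f : PolyRing K n} (hf : f ∈ antiDiagList K n) :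
    f.IsHomogeneous 2 := by
  obtain ⟨i, -, rfl⟩ := List.mem_map.1 hf
  exact (isHomogeneous_commMatrix K n i i.rev).neg

variable [NeZero n]

/-- The involution of `K[X, Y]` that replaces `y_{i1}` by `x_{1,n+1-i} - y_{i1}`, on variables. -/
def shearVar : (Fin n × Fin n) ⊕ (Fin n × Fin n) → PolyRing K n
  | Sum.inl p => X (Sum.inl p)
  | Sum.inr p => if p.2 = 0 then X (Sum.inl (0, p.1.rev)) - X (Sum.inr p) else X (Sum.inr p)

theorem aeval_shearVar_comp_self :
    (aeval (shearVar K n)).comp (aeval (shearVar K n)) = AlgHom.id K (PolyRing K n) := by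
  ext1 v
  rcases v with p | ⟨i, j⟩
  · simp [shearVar]
  · by_cases h : j = 0 <;> simp [shearVar, h]

/-- The involution of `K[X, Y]` that replaces `y_{i1}` by `x_{1,n+1-i} - y_{i1}`. -/
def shear : PolyRing K n ≃ₐ[K] PolyRing K n :=
  AlgEquiv.ofAlgHom (aeval (shearVar K n)) (aeval (shearVar K n))
    (aeval_shearVar_comp_self K n) (aeval_shearVar_comp_self K n)

@[simp]
theorem shear_X (v : (Fin n × Fin n) ⊕ (Fin n × Fin n)) : shear K n (X v) = shearVar K n v :=
  aeval_X _ v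

/-- The variables corresponding to `parameterList` under `shear`. -/
def parameterVars : List ((Fin n × Fin n) ⊕ (Fin n × Fin n)) :=
  ((List.finRange n ×ˢ List.finRange n).filter fun p => p.1 ≠ 0).map Sum.inl ++
    ((List.finRange n ×ˢ List.finRange n).filter fun p => p.2 ≠ 0).map Sum.inr ++
    (List.finRange n).map fun j => Sum.inr (j.rev, 0)

/-- The variables of the first row of the first matrix. -/
def rowVars : List ((Fin n × Fin n) ⊕ (Fin n × Fin n)) :=
  (List.finRange n).map fun j => Sum.inl (0, j.rev)

theorem mem_parameterVars_append (v : (Fin n × Fin n) ⊕ (Fin n × Fin n)) :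
    v ∈ parameterVars n ++ rowVars n := by
  rcases v with ⟨i, j⟩ | ⟨i, j⟩
  · by_cases h : i = 0
    · exact List.mem_append_right _ (List.mem_map.2 ⟨j.rev, by simp, by simp [h]⟩)
    · simp [parameterVars, h]
  · by_cases h : j = 0
    · refine List.mem_append_left _ (List.mem_append_right _
        (List.mem_map.2 ⟨i.rev, by simp, by simp [h]⟩))
    · simp [parameterVars, h]

theorem nodup_parameterVars_append : (parameterVars n ++ rowVars n).Nodup := by
  have hp : (List.finRange n ×ˢ List.finRange n).Nodup :=
    (List.nodup_finRange n).product (List.nodup_finRange n)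
  rw [parameterVars, rowVars, List.nodup_append', List.nodup_append', List.nodup_append']
  refine ⟨⟨⟨(hp.filter _).map Sum.inl_injective, (hp.filter _).map Sum.inr_injective, ?_⟩,
    (List.nodup_finRange n).map fun i j h => by simpa using h, ?_⟩,
    (List.nodup_finRange n).map fun i j h => by simpa using h, ?_⟩
  · intro v h1 h2
    simp only [List.mem_map] at h1 h2
    grind
  · intro v h1 h2
    simp only [List.mem_append, List.mem_map, List.mem_filter] at h1 h2
    grind
  · intro v h1 h2
    simp only [List.mem_append, List.mem_map, List.mem_filter] at h1 h2
    grind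

theorem length_parameterVars_add : (parameterVars n).length + n = 2 * n ^ 2 := by
  have h := (List.toFinset_card_of_nodup (nodup_parameterVars_append n)).symm
  rw [show (parameterVars n ++ rowVars n).toFinset = Finset.univ from
    Finset.eq_univ_iff_forall.2 fun v => List.mem_toFinset.2 (mem_parameterVars_append n v),
    Finset.card_univ, Fintype.card_sum, Fintype.card_prod, Fintype.card_fin,
    List.length_append] at h
  simp only [rowVars, List.length_map, List.length_finRange] at h
  rw [h]
  ring

theorem parameterList_eq_map_shear :
    parameterList K n = (parameterVars n).map fun v => shear K n (X v) := by
  simp only [parameterList, parameterVars, List.map_append, List.map_map]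
  refine congrArg₂ _ (congrArg₂ _ ?_ ?_) ?_
  · simp [shearVar, matX]
  · refine List.map_congr_left fun p hp => ?_
    have : p.2 ≠ 0 := by simpa using (List.mem_filter.1 hp).2
    simp [shearVar, this, matY]
  · simp [shearVar, matX, matY, Function.comp_def]

theorem length_parameterList : (parameterList K n).length = (parameterVars n).length := by
  rw [parameterList_eq_map_shear, List.length_map]

/-- Transport of powers of distinct variables along `shear`. The order `i.rev` matches
`antiDiagList` term by term. -/
theorem isWeaklyRegular_parameterList_append_sq : IsWeaklyRegular (PolyRing K n)
    (parameterList K n ++ (List.finRange n).map fun i => matX K n 0 i.rev ^ 2) := by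
  have h := isWeaklyRegular_map_X_pow (R := K)
    ((parameterVars n).map (fun v => (v, 1)) ++ (rowVars n).map fun v => (v, 2))
    (by simpa [Function.comp_def] using nodup_parameterVars_append n)
  have h2 := (AddEquiv.isWeaklyRegular_congr (e := (shear K n).toRingEquiv.toAddEquiv)
    (List.forall₂_map_right_iff (f := shear K n) |>.2
      (List.forall₂_same.2 fun r _ x => map_mul (shear K n) r x))).1 h
  convert h2 using 1
  rw [parameterList_eq_map_shear]
  simp [rowVars, shearVar, matX, Function.comp_def]

/-! ### The quotient by the parameters -/

/-- The substitution that kills the variables off the first row of `X` and off the first column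
of `Y`, and sends `x_{1j}` and `y_{n-j+1,1}` to the `j`-th variable. -/
def restrictVar : (Fin n × Fin n) ⊕ (Fin n × Fin n) → MvPolynomial (Fin n) K
  | Sum.inl p => if p.1 = 0 then X p.2 else 0
  | Sum.inr p => if p.2 = 0 then X p.1.rev else 0

/-- The substitution `restrictVar` as an algebra homomorphism. -/
def restrict : PolyRing K n →ₐ[K] MvPolynomial (Fin n) K := aeval (restrictVar K n)

@[simp]
theorem restrict_matX (i j : Fin n) :
    restrict K n (matX K n i j) = if i = 0 then X j else 0 := by
  simp [restrict, matX, restrictVar]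

@[simp]
theorem restrict_matY (i j : Fin n) :
    restrict K n (matY K n i j) = if j = 0 then X i.rev else 0 := by
  simp [restrict, matY, restrictVar]

theorem restrict_eq_zero_of_mem {f : PolyRing K n} (hf : f ∈ Ideal.ofList (parameterList K n)) :
    restrict K n f = 0 := by
  suffices h : Ideal.ofList (parameterList K n) ≤ RingHom.ker (restrict K n) from h hf
  refine Ideal.span_le.2 fun f hf => ?_
  simp only [parameterList, Set.mem_ofPred_eq, List.mem_append, List.mem_map, List.mem_filter] at hf
  rw [SetLike.mem_coe, RingHom.mem_ker]
  rcases hf with (⟨p, ⟨-, hp⟩, rfl⟩ | ⟨p, ⟨-, hp⟩, rfl⟩) | ⟨j, -, rfl⟩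
  · simpa using hp
  · simpa using hp
  · simp

theorem matX_mem_parameterIdeal {i : Fin n} (hi : i ≠ 0) (j : Fin n) :
    matX K n i j ∈ Ideal.ofList (parameterList K n) :=
  Ideal.subset_span (List.mem_append_left _ (List.mem_append_left _
    (List.mem_map.2 ⟨(i, j), by simp [hi], rfl⟩)))

theorem matY_mem_parameterIdeal (i : Fin n) {j : Fin n} (hj : j ≠ 0) :
    matY K n i j ∈ Ideal.ofList (parameterList K n) :=
  Ideal.subset_span (List.mem_append_left _ (List.mem_append_right _
    (List.mem_map.2 ⟨(i, j), by simp [hj], rfl⟩)))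

theorem matX_sub_matY_mem_parameterIdeal (j : Fin n) :
    matX K n 0 j - matY K n j.rev 0 ∈ Ideal.ofList (parameterList K n) :=
  Ideal.subset_span (List.mem_append_right _ (List.mem_map.2 ⟨j, by simp, rfl⟩))

/-- The quotient by the parameters is the polynomial ring in the first row of `X`. -/
def parameterQuotientEquiv :
    (PolyRing K n ⧸ Ideal.ofList (parameterList K n)) ≃ₐ[K] MvPolynomial (Fin n) K :=
  AlgEquiv.ofAlgHom
    (Ideal.Quotient.liftₐ _ (restrict K n) fun _ => restrict_eq_zero_of_mem K n)
    (aeval fun j => Ideal.Quotient.mk _ (matX K n 0 j))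
    (by
      ext1 j
      rw [AlgHom.comp_apply, aeval_X]
      exact (restrict_matX K n 0 j).trans (if_pos rfl))
    (by
      refine Ideal.Quotient.algHom_ext _ (MvPolynomial.algHom_ext fun v => ?_)
      rcases v with ⟨i, j⟩ | ⟨i, j⟩
      · change aeval _ (restrict K n (matX K n i j)) = Ideal.Quotient.mk _ (matX K n i j)
        by_cases h : i = 0
        · simp [h]
        · simp [h, Ideal.Quotient.eq_zero_iff_mem.2 (matX_mem_parameterIdeal K n h j)]
      · change aeval _ (restrict K n (matY K n i j)) = Ideal.Quotient.mk _ (matY K n i j)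
        by_cases h : j = 0
        · subst h
          have := Ideal.Quotient.eq.2 (matX_sub_matY_mem_parameterIdeal K n i.rev)
          simpa using this
        · simp [h, Ideal.Quotient.eq_zero_iff_mem.2 (matY_mem_parameterIdeal K n i h)])

@[simp]
theorem parameterQuotientEquiv_mk (f : PolyRing K n) :
    parameterQuotientEquiv K n (Ideal.Quotient.mk _ f) = restrict K n f := rfl

theorem mem_parameterIdeal_iff {f : PolyRing K n} :
    f ∈ Ideal.ofList (parameterList K n) ↔ restrict K n f = 0 := by
  rw [← parameterQuotientEquiv_mk, map_eq_zero_iff _ (parameterQuotientEquiv K n).injective,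
    Ideal.Quotient.eq_zero_iff_mem]

variable {n}

/-- A term of `XY` survives only if `i` and `i.rev` are both `0`, impossible for `n ≥ 2`; in `YX`
only `k = 0` survives, and both its factors become `X i.rev`. -/
theorem restrict_commMatrix_rev (hn : 2 ≤ n) (i : Fin n) :
    restrict K n (commMatrix K n i i.rev) = -X i.rev ^ 2 := by
  have h : ¬ (i = 0 ∧ i.rev = 0) := by
    rintro ⟨rfl, h⟩
    have := congrArg Fin.val h
    simp [Fin.val_rev] at this
    omega
  rw [commMatrix, Matrix.sub_apply, Matrix.mul_apply, Matrix.mul_apply, map_sub, map_sum, map_sum]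
  have h1 : ∀ k, restrict K n (matX K n i k * matY K n k i.rev) = 0 := by
    intro k
    rw [map_mul, restrict_matX, restrict_matY]
    by_cases h0 : i = 0
    · simp [show i.rev ≠ 0 from fun h' => h ⟨h0, h'⟩]
    · simp [h0]
  rw [Finset.sum_eq_zero fun k _ => h1 k, Finset.sum_eq_single 0 (by
    intro k _ hk
    simp [hk]) (by simp)]
  simp [sq]

variable (n)

theorem isHomogeneous_of_mem_parameterList {f : PolyRing K n} (hf : f ∈ parameterList K n) :
    f.IsHomogeneous 1 := by
  simp only [parameterList, List.mem_append, List.mem_map, List.mem_filter] at hf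
  rcases hf with (⟨p, -, rfl⟩ | ⟨p, -, rfl⟩) | ⟨j, -, rfl⟩
  · exact isHomogeneous_X K _
  · exact isHomogeneous_X K _
  · exact (isHomogeneous_X K _).sub (isHomogeneous_X K _)

/-! ### Regularity and dimension count -/

variable {K n}

theorem isWeaklyRegular_antiDiagList_append (hn : 2 ≤ n) {rs : List (PolyRing K n)}
    (hrs : rs.Perm (parameterList K n)) :
    IsWeaklyRegular (PolyRing K n) (antiDiagList K n ++ rs) := by
  have h : IsWeaklyRegular (PolyRing K n) (parameterList K n ++ antiDiagList K n) := by
    -- The sign in `antiDiagList` makes its entries congruent to the squares themselves.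
    refine isWeaklyRegular_append_congr ?_ (isWeaklyRegular_parameterList_append_sq K n)
    rw [antiDiagList, List.forall₂_map_left_iff, List.forall₂_map_right_iff]
    refine List.forall₂_same.2 fun i _ => ?_
    rw [mem_parameterIdeal_iff, map_sub, map_neg, restrict_commMatrix_rev K hn]
    simp
  let _ := MvPolynomial.gradedAlgebra (σ := (Fin n × Fin n) ⊕ (Fin n × Fin n)) (R := K)
  refine h.perm_of_homogeneous
    (homogeneousSubmodule ((Fin n × Fin n) ⊕ (Fin n × Fin n)) K)
    (List.perm_append_comm.trans (hrs.symm.append_left _)) fun f hf => ?_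
  rcases List.mem_append.1 hf with hf | hf
  · exact ⟨1, one_pos, isHomogeneous_of_mem_parameterList K n hf⟩
  · exact ⟨2, two_pos, isHomogeneous_of_mem_antiDiagList K n hf⟩

/-- All generators have zero constant term, so evaluation at the origin factors through `R/J` and
kills the ideal. -/
theorem ofList_map_antiDiag_ne_top {rs : List (PolyRing K n)}
    (hrs : rs.Perm (parameterList K n)) :
    Ideal.ofList (rs.map (Ideal.Quotient.mk (antiDiagIdeal K n))) ≠ ⊤ := by
  let ε : PolyRing K n →+* K := constantCoeff
  have h0 : ∀ {f : PolyRing K n} {d : ℕ}, f.IsHomogeneous d → d ≠ 0 → ε f = 0 := by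
    intro f d hf hd
    by_contra h
    exact hd (by simpa using (hf h).symm)
  have hJ : ∀ f ∈ antiDiagIdeal K n, ε f = 0 := by
    intro f hf
    suffices h : antiDiagIdeal K n ≤ RingHom.ker ε from h hf
    refine Ideal.span_le.2 ?_
    rintro _ ⟨i, rfl⟩
    exact h0 (isHomogeneous_commMatrix K n i i.rev) two_ne_zero
  refine ne_top_of_le_ne_top (RingHom.ker_ne_top (Ideal.Quotient.lift _ ε hJ))
    (Ideal.span_le.2 fun f hf => ?_)
  obtain ⟨g, hg, rfl⟩ := List.mem_map.1 hf
  exact h0 (isHomogeneous_of_mem_parameterList K n (hrs.mem_iff.1 hg)) one_ne_zero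

end CommutatorMatrix

end

open CommutatorMatrix RingTheory.Sequence in
theorem CommutatorMatrix.isHomogeneousSystemOfParameters_and_isRegular
    {K : Type*} [Field K] {n : ℕ} [NeZero n] (hn : 2 ≤ n)
    {rs : List (PolyRing K n)} (hrs : rs.Perm (parameterList K n)) :
    IsHomogeneousSystemOfParameters (antiDiagGrading K n)
        (rs.map (Ideal.Quotient.mk (antiDiagIdeal K n))) ∧
      IsRegular (PolyRing K n ⧸ antiDiagIdeal K n)
        (rs.map (Ideal.Quotient.mk (antiDiagIdeal K n))) := by
  have happ := isWeaklyRegular_antiDiagList_append hn hrs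
  have hweak := happ.map_quotient_of_append (ofList_antiDiagList K n)
  have htop := ofList_map_antiDiag_ne_top hrs
  have h1 := ((isWeaklyRegular_append_iff _ _ _).1 happ).1.ringKrullDim_add_length_le
  have h2 := hweak.ringKrullDim_add_length_le
  rw [ofList_antiDiagList, MvPolynomial.ringKrullDim_of_isNoetherianRing,
    ringKrullDim_eq_zero_of_field] at h1
  have hlen := length_parameterVars_add n
  rw [← length_parameterList K n, ← hrs.length_eq] at hlen
  have hcard : Nat.card ((Fin n × Fin n) ⊕ (Fin n × Fin n)) = rs.length + n := by
    rw [hlen]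
    simp
    ring
  rw [hcard, antiDiagList, List.length_map, List.length_finRange] at h1
  rw [List.length_map] at h2
  have : Nontrivial ((PolyRing K n ⧸ antiDiagIdeal K n) ⧸
      Ideal.ofList (rs.map (Ideal.Quotient.mk (antiDiagIdeal K n)))) :=
    Ideal.Quotient.nontrivial_iff.2 htop
  have h0 := ringKrullDim_nonneg_of_nontrivial (R := ((PolyRing K n ⧸ antiDiagIdeal K n) ⧸
      Ideal.ofList (rs.map (Ideal.Quotient.mk (antiDiagIdeal K n)))))
  -- Applied with `E = dim R/J`, `D` the dimension modulo the parameters, `m` their number and `k =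
  -- n`, so that `m + k = dim R`.
  have key : ∀ (D E : WithBot ℕ∞) (m k : ℕ), E + k ≤ 0 + ((m + k : ℕ) : WithBot ℕ∞) →
      D + m ≤ E → 0 ≤ D → E = m ∧ D = 0 := by
    intro D E m k hE hD h
    obtain ⟨d, rfl⟩ := WithBot.ne_bot_iff_exists.1 (ne_bot_of_le_ne_bot WithBot.zero_ne_bot h)
    obtain ⟨e, rfl⟩ := WithBot.ne_bot_iff_exists.1
      (ne_bot_of_le_ne_bot (WithBot.add_ne_bot.2 ⟨WithBot.coe_ne_bot, WithBot.natCast_ne_bot m⟩) hD)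
    rw [zero_add] at hE
    norm_cast at hE hD ⊢
    have he : e ≠ ⊤ := by
      rintro rfl
      simp at hE
    lift e to ℕ using he
    have hd : d ≠ ⊤ := by
      rintro rfl
      simp at hD
    lift d to ℕ using hd
    norm_cast at hE hD ⊢
    omega
  obtain ⟨hE, hD⟩ := key _ _ _ _ h1 h2 h0
  refine ⟨⟨?_, by rw [hE, List.length_map], hD⟩, hweak, ?_⟩
  · intro f hf
    obtain ⟨g, hg, rfl⟩ := List.mem_map.1 hf
    exact ⟨1, one_pos, g, isHomogeneous_of_mem_parameterList K n (hrs.mem_iff.1 hg), rfl⟩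
  · rw [smul_eq_mul, Ideal.mul_top]
    exact htop.symm

open CommutatorMatrix in
theorem mainTheorem11 (K : Type*) [Field K] (n : ℕ) [NeZero n] (hn : 3 ≤ n) :
    (∀ rs : List (PolyRing K n), rs.Perm (parameterList K n) →
      IsHomogeneousSystemOfParameters (antiDiagGrading K n)
        (rs.map (Ideal.Quotient.mk (antiDiagIdeal K n))) ∧
      RingTheory.Sequence.IsRegular (PolyRing K n ⧸ antiDiagIdeal K n)
        (rs.map (Ideal.Quotient.mk (antiDiagIdeal K n)))) ∧
    ∃ φ : (PolyRing K n ⧸ Ideal.ofList (parameterList K n)) ≃ₐ[K] MvPolynomial (Fin n) K,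
      (∀ j : Fin n, φ (Ideal.Quotient.mk _ (matX K n 0 j)) = MvPolynomial.X j) ∧
      ((antiDiagIdeal K n).map (Ideal.Quotient.mk (Ideal.ofList (parameterList K n)))).map φ =
        Ideal.span (Set.range fun j : Fin n => (MvPolynomial.X j : MvPolynomial (Fin n) K) ^ 2) := by
  have hn2 : 2 ≤ n := by omega
  refine ⟨fun rs hrs => isHomogeneousSystemOfParameters_and_isRegular hn2 hrs,
    parameterQuotientEquiv K n, fun j => by simp, ?_⟩
  rw [antiDiagIdeal, Ideal.map_span, Ideal.map_span, ← Set.range_comp, ← Set.range_comp]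
  refine .trans ?_ (Ideal.span_range_neg _)
  refine congrArg Ideal.span (Set.ext fun f => ?_)
  simp only [Set.mem_range, Function.comp_apply, parameterQuotientEquiv_mk,
    restrict_commMatrix_rev K hn2]
  exact Fin.revPerm.exists_congr_left.trans (by simp)
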